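/- Definitions. An unfair metrical task system (UMTS) $U=(M;r_1,\dots,r_b)$ consists of a metric space $M=\{v_1,\dots,v_b\}$ and cost ratios $r_1,\dots,r_b>0$. A task is a vector $(c_1,\dots,c_b)$ of nonnegative costs; serving it by moving from $v_i$ to $v_j$ costs an online algorithm $d(v_i,v_j)+r_jc_j$ and costs an offline algorithm $d(v_i,v_j)+c_j$. An online algorithm chooses each point from its starting point and the tasks seen so far, including the current one. The elementary task $(v,\delta)$ has cost $\delta$ at $v$ and $0$ elsewhere. Write $\mathrm{cost}_A(\sigma,u_0)$ for the cost of the online algorithm $A$ on the task sequence $\sigma$ when started at $u_0$, and $\mathrm{cost}_{\mathrm{OPT}^0}(\sigma,u_0)$ for the minimum offline cost of serving $\sigma$ from $u_0$ and then returning to $u_0$. Let $\Delta>0$ be the diameter of $M$. For $\beta>0$, an $(r,\beta)$-adversary is a probability distribution $\mathcal D$ on finite sequences of elementary tasks such that $$\min_{u_0}\mathrm E_{\sigma\in\mathcal D}[\mathrm{cost}_{\mathrm{OPT}^0}(\sigma,u_0)]\le\beta\Delta\quad\text{and}\quad \min_{u_0}\mathrm E_{\sigma\in\mathcal D}[\mathrm{cost}_A(\sigma,u_0)]\ge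 r\beta\Delta$$ for every deterministic online algorithm $A$. It is an $(r,\beta;\alpha_1,\dots,\alpha_b)$-discrete adversary if it uses only tasks of the form $(v_i,\alpha_i\Delta)$. Let $\mathcal U_b^\Delta$ be the uniform metric space on $b$ points in which all distances between distinct points equal $\Delta>0$. Statement. There exist constants $\lambda_3,\rho>0$ such that for every $b\ge2$, every $\Delta>0$ and every UMTS $U=(\mathcal U_b^\Delta;r_1,\dots,r_b)$ with $r_1\ge r_2\ge\cdots\ge r_b\ge1$ the following hold. (a) If $r_1\ge\frac14\ln b$, then there is an $(r,\beta;r_1^{-1},\dots,r_b^{-1})$-discrete adversary for $U$ with $\beta\le\lambda_3r_1$ and $r\ge\rho\ln\bigl(\sum_{i=1}^b e^{\rho^{-1}r_i}\bigr)$. (b) If $n_1,\dots,n_b>0$ satisfy $r_i=\rho(1+\ln n_i)$ for all $i$, then there is an $(r,\beta;\alpha_1,\dots,\alpha_b)$-discrete adversary for $U$ with $r\ge\rho\bigl(1+\ln\sum_{i=1}^b n_i\bigr)$, $\beta\le\lambda_3r_1$ and $\min_i\alpha_i\ge r_1^{-1}$. -/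

import Mathlib

open scoped NNReal ENNReal

noncomputable section

/-- A task on `b` points assigns a nonnegative processing cost to every point. Infinite costs, which
no discrete adversary uses, are left out. -/
abbrev TaskVec (b : ℕ) : Type := Fin b → ℝ≥0

/-- The elementary task `(v, δ)`: cost `δ` at the point `v` and `0` at every other point. -/
structure ElementaryTask (b : ℕ) where
  point : Fin b
  size : ℝ≥0

/-- The elementary task `(v, δ)` as a vector of processing costs. -/
def ElementaryTask.toTask {b : ℕ} (e : ElementaryTask b) : TaskVec b :=
  Pi.single e.point e.size

/-- An unfair metrical task system `(M; r₁, …, r_b; s)`: a metric on `b` points, positive cost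
ratios and a positive distance ratio. -/
structure UMTS (b : ℕ) where
  metric : MetricSpace (Fin b)
  costRatio : Fin b → ℝ
  costRatio_pos : ∀ i, 0 < costRatio i
  distRatio : ℝ
  distRatio_pos : 0 < distRatio

namespace UMTS

variable {b : ℕ} (U : UMTS b)

/-- The distance between two points of the system. -/
def d (i j : Fin b) : ℝ := U.metric.dist i j

/-- The diameter of the underlying metric space. -/
def diam : ℝ := @Metric.diam (Fin b) U.metric.toPseudoMetricSpace Set.univ

/-- The underlying metric space is uniform: distinct points are at distance `Δ`. -/
def IsUniform (Δ : ℝ) : Prop := ∀ i j : Fin b, i ≠ j → U.d i j = Δ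

/-- The offline (fair) cost of being at the point `p t` after the `t`-th task of `σ`, where
`p 0` is the initial point. -/
def offlineCost (σ : List (TaskVec b)) (p : ℕ → Fin b) : ℝ :=
  ∑ t : Fin σ.length, (U.d (p t) (p (t + 1)) + (σ.get t (p (t + 1)) : ℝ))

/-- The online (unfair) cost of being at the point `p t` after the `t`-th task of `σ`, where
`p 0` is the initial point. -/
def onlineCost (σ : List (TaskVec b)) (p : ℕ → Fin b) : ℝ :=
  ∑ t : Fin σ.length, (U.distRatio * U.d (p t) (p (t + 1)) +
    U.costRatio (p (t + 1)) * (σ.get t (p (t + 1)) : ℝ))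

/-- The optimal offline cost of serving `σ` from `u₀` and then returning to `u₀`. -/
def opt0 (σ : List (TaskVec b)) (u₀ : Fin b) : ℝ :=
  ⨅ p : {p : ℕ → Fin b // p 0 = u₀}, (U.offlineCost σ p.1 + U.d (p.1 σ.length) u₀)

end UMTS

/-- A deterministic online algorithm: `state u₀ τ` is the point occupied after the tasks `τ` have
been received and served, when the initial point is `u₀`. -/
structure OnlineAlgorithm (b : ℕ) where
  state : Fin b → List (TaskVec b) → Fin b
  state_nil : ∀ u₀, state u₀ [] = u₀

namespace UMTS

variable {b : ℕ} (U : UMTS b)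

/-- The cost of the online algorithm `A` on `σ` when it starts at `u₀`. -/
def algCost (A : OnlineAlgorithm b) (σ : List (TaskVec b)) (u₀ : Fin b) : ℝ :=
  U.onlineCost σ fun t => A.state u₀ (σ.take t)

end UMTS

/-- The expectation of a nonnegative cost when a sequence of elementary tasks is drawn
from `D`. It is taken in `[0, ∞]`, so that no integrability question arises. -/
def expectedCost {b : ℕ} (D : PMF (List (ElementaryTask b))) (cost : List (TaskVec b) → ℝ) : ℝ≥0∞ :=
  ∑' σ, D σ * ENNReal.ofReal (cost (σ.map ElementaryTask.toTask))

namespace UMTS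

variable {b : ℕ} (U : UMTS b)

/-- `D` is an `(r, β)`-adversary for `U`. The scale `β` is positive: with `β = 0` the empty task
sequence would be an `(r, 0)`-adversary for every `r`. -/
structure IsAdversary (r β : ℝ) (D : PMF (List (ElementaryTask b))) : Prop where
  diam_pos : 0 < U.diam
  beta_pos : 0 < β
  offline_le : ⨅ u₀, expectedCost D (fun σ => U.opt0 σ u₀) ≤ ENNReal.ofReal (β * U.diam)
  le_online : ∀ A : OnlineAlgorithm b,
    ENNReal.ofReal (r * (β * U.diam)) ≤ ⨅ u₀, expectedCost D (fun σ => U.algCost A σ u₀)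

/-- `D` is an `(r, β; α₁, …, α_b)`-discrete adversary for `U`: an `(r, β)`-adversary all of whose
tasks have the form `(vᵢ, αᵢ Δ)`, with `Δ` the diameter. There are finitely many such tasks, hence
countably many task sequences, so a `PMF` is here the general notion of a distribution. -/
structure IsDiscreteAdversary (r β : ℝ) (α : Fin b → ℝ) (D : PMF (List (ElementaryTask b))) :
    Prop extends U.IsAdversary r β D where
  size_eq : ∀ σ ∈ D.support, ∀ e ∈ σ, (e.size : ℝ) = α e.point * U.diam

end UMTS

end

/-! In each of `K` rounds, every point `i` in turn is hit with probability `1/2` by a task of size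
`Δ / rᵢ`. An online algorithm loses at least `Δ / 2` per round in expectation: when the coin of the
point it occupies is tossed, the hit comes with probability `1/2` and costs `Δ`, and so does leaving
before the toss. Offline, staying at `u` costs about `K Δ / (2 r_u)`, and moving to another point
pays off if that point is hit far less often than expected.

Binomial fluctuations supply such a point. Let `R = r_u` be maximal and let `S` be a set of `m`
other points with ratios at least `R - x`. By anticoncentration, with probability about
`min 1 (m 8⁻ˢ)` the number of hits of some point of `S` is below its mean by the order of
`√(s K)`. For `K ≈ R² / s` this makes the move worthwhile as long as `x` is at most a small multiple
of `s`, and the competitive ratio exceeds `R` by the order of `s min 1 (m 8⁻ˢ)`.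

Since `∑ 1/(k + 1)² ≤ 1`, some superlevel set `S` of the ratios satisfies
`∑_{i ≠ u} e^{rᵢ/ρ} ≤ (m + 1)² e^{(R - x)/ρ}`, and a suitable `s` for this `S` gives the bound. If
`x` is comparable with `R`, a single point that is never hit suffices, and if `ln b` is much larger
than `R`, then after about `ln b / 2` rounds some point has most likely never been hit.
-/

section RandomSublist

variable {ι : Type*}

/-- The average of `F` over the sublists of `l`, that is, its expectation at the random sublist
which keeps each entry of `l` according to the toss of a fair coin. -/
noncomputable def sublistAvg (l : List ι) (F : List ι → ℝ) : ℝ :=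
  (l.sublists'.map F).sum / 2 ^ l.length

@[simp]
theorem sublistAvg_nil (F : List ι → ℝ) : sublistAvg [] F = F [] := by
  simp [sublistAvg]

theorem sublistAvg_cons (v : ι) (l : List ι) (F : List ι → ℝ) :
    sublistAvg (v :: l) F = (sublistAvg l F + sublistAvg l fun σ => F (v :: σ)) / 2 := by
  simp only [sublistAvg, List.sublists'_cons, List.map_append, List.map_map, List.sum_append,
    List.length_cons, pow_succ, Function.comp_def]
  ring

theorem sublistAvg_mono {l : List ι} {F G : List ι → ℝ} (h : ∀ σ, σ.Sublist l → F σ ≤ G σ) :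
    sublistAvg l F ≤ sublistAvg l G :=
  div_le_div_of_nonneg_right
    (List.sum_le_sum fun σ hσ => h σ (List.mem_sublists'.1 hσ)) (by positivity)

@[simp]
theorem sublistAvg_const (l : List ι) (c : ℝ) : sublistAvg l (fun _ => c) = c := by
  simp [sublistAvg]

theorem sublistAvg_add (l : List ι) (F G : List ι → ℝ) :
    sublistAvg l (fun σ => F σ + G σ) = sublistAvg l F + sublistAvg l G := by
  simp only [sublistAvg, List.sum_map_add, add_div]

theorem sublistAvg_mul_left (l : List ι) (c : ℝ) (F : List ι → ℝ) :
    sublistAvg l (fun σ => c * F σ) = c * sublistAvg l F := by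
  simp only [sublistAvg, List.sum_map_mul_left, mul_div_assoc]

theorem sublistAvg_sub (l : List ι) (F G : List ι → ℝ) :
    sublistAvg l (fun σ => F σ - G σ) = sublistAvg l F - sublistAvg l G := by
  have h := sublistAvg_add l (fun σ => F σ - G σ) G
  simp only [sub_add_cancel] at h
  exact eq_sub_of_add_eq h.symm

theorem sublistAvg_append (l₁ l₂ : List ι) (F : List ι → ℝ) :
    sublistAvg (l₁ ++ l₂) F = sublistAvg l₁ fun σ => sublistAvg l₂ fun τ => F (σ ++ τ) := by
  induction l₁ generalizing F with
  | nil => simp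
  | cons v l ih => simp only [List.cons_append, sublistAvg_cons, ih]

/-- The probability that the random sublist of `l` has the property `E`. -/
noncomputable def sublistProb (l : List ι) (E : Set (List ι)) : ℝ :=
  sublistAvg l (E.indicator 1)

theorem sublistProb_mono {l : List ι} {E E' : Set (List ι)}
    (h : ∀ σ, σ.Sublist l → σ ∈ E → σ ∈ E') : sublistProb l E ≤ sublistProb l E' := by
  refine sublistAvg_mono fun σ hσ => ?_
  by_cases hE : σ ∈ E
  · simp [hE, h σ hσ hE]
  · rw [Set.indicator_of_notMem hE]
    exact Set.indicator_nonneg (fun _ _ => zero_le_one) σ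

theorem sublistProb_diff {l : List ι} {E E' : Set (List ι)} (h : E' ⊆ E) :
    sublistProb l (E \ E') = sublistProb l E - sublistProb l E' := by
  rw [sublistProb, Set.indicator_sdiff h]
  exact sublistAvg_sub l _ _

end RandomSublist

section Binomial

/-- The expectation of `g` at the number of heads among `n` tosses of a fair coin. -/
noncomputable def binomialAvg (n : ℕ) (g : ℕ → ℝ) : ℝ :=
  sublistAvg (List.replicate n ()) fun σ => g σ.length

@[simp]
theorem binomialAvg_zero (g : ℕ → ℝ) : binomialAvg 0 g = g 0 := by
  simp [binomialAvg]

theorem binomialAvg_succ (n : ℕ) (g : ℕ → ℝ) :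
    binomialAvg (n + 1) g = (binomialAvg n g + binomialAvg n fun k => g (k + 1)) / 2 := by
  simp only [binomialAvg, List.replicate_succ, sublistAvg_cons, List.length_cons]

theorem binomialAvg_mono {n : ℕ} {g h : ℕ → ℝ} (H : ∀ k, g k ≤ h k) :
    binomialAvg n g ≤ binomialAvg n h :=
  sublistAvg_mono fun _ _ => H _

@[simp]
theorem binomialAvg_const (n : ℕ) (c : ℝ) : binomialAvg n (fun _ => c) = c :=
  sublistAvg_const _ c

theorem binomialAvg_add (n : ℕ) (g h : ℕ → ℝ) :
    binomialAvg n (fun k => g k + h k) = binomialAvg n g + binomialAvg n h :=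
  sublistAvg_add _ _ _

theorem binomialAvg_mul_left (n : ℕ) (c : ℝ) (g : ℕ → ℝ) :
    binomialAvg n (fun k => c * g k) = c * binomialAvg n g :=
  sublistAvg_mul_left _ _ _

theorem binomialAvg_sub (n : ℕ) (g h : ℕ → ℝ) :
    binomialAvg n (fun k => g k - h k) = binomialAvg n g - binomialAvg n h :=
  sublistAvg_sub _ _ _

theorem binomialAvg_nat_add (m n : ℕ) (g : ℕ → ℝ) :
    binomialAvg (m + n) g = binomialAvg m fun a => binomialAvg n fun b => g (a + b) := by
  simp only [binomialAvg, List.replicate_add, sublistAvg_append, List.length_append]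

theorem binomialAvg_cast (n : ℕ) : binomialAvg n (fun k => (k : ℝ)) = n / 2 := by
  induction n with
  | zero => simp
  | succ n ih =>
    simp only [binomialAvg_succ, Nat.cast_add, Nat.cast_one, binomialAvg_add, ih,
      binomialAvg_const]
    ring

/-- The probability that the number of heads among `n` tosses of a fair coin lies in `s`. -/
noncomputable def binomialProb (n : ℕ) (s : Set ℕ) : ℝ :=
  binomialAvg n (s.indicator 1)

theorem binomialProb_nonneg (n : ℕ) (s : Set ℕ) : 0 ≤ binomialProb n s := by
  rw [← binomialAvg_const n 0]
  exact binomialAvg_mono fun k => Set.indicator_nonneg (fun _ _ => zero_le_one) k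

theorem binomialProb_mono {n : ℕ} {s t : Set ℕ} (h : s ⊆ t) :
    binomialProb n s ≤ binomialProb n t :=
  binomialAvg_mono <| Set.indicator_le_indicator_of_subset h fun _ => zero_le_one

theorem binomialProb_compl (n : ℕ) (s : Set ℕ) : binomialProb n sᶜ = 1 - binomialProb n s := by
  rw [binomialProb, Set.indicator_compl]
  exact (binomialAvg_sub n _ _).trans <| by
    rw [show (1 : ℕ → ℝ) = fun _ => 1 from rfl, binomialAvg_const]; rfl

theorem binomialProb_le_one (n : ℕ) (s : Set ℕ) : binomialProb n s ≤ 1 := by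
  linarith [binomialProb_compl n s, binomialProb_nonneg n sᶜ]

theorem binomialProb_union_le (n : ℕ) (s t : Set ℕ) :
    binomialProb n (s ∪ t) ≤ binomialProb n s + binomialProb n t := by
  simp only [binomialProb, ← binomialAvg_add]
  refine binomialAvg_mono fun k => ?_
  by_cases hs : k ∈ s <;> by_cases ht : k ∈ t <;> simp [hs, ht]

theorem binomialProb_singleton_zero (n : ℕ) : binomialProb n {0} = (1 / 2) ^ n := by
  induction n with
  | zero => simp [binomialProb]
  | succ n ih =>
    have h : (fun k : ℕ => ({0} : Set ℕ).indicator (1 : ℕ → ℝ) (k + 1)) = fun _ => 0 := by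
      ext k; simp
    rw [binomialProb] at ih ⊢
    rw [binomialAvg_succ, ih, h, binomialAvg_const, pow_succ]
    ring

open Pointwise in
theorem binomialProb_mul_le_binomialProb_add (m n : ℕ) (s t : Set ℕ) :
    binomialProb m s * binomialProb n t ≤ binomialProb (m + n) (s + t) := by
  simp only [binomialProb, binomialAvg_nat_add]
  rw [mul_comm, ← binomialAvg_mul_left]
  refine binomialAvg_mono fun a => ?_
  rw [mul_comm, ← binomialAvg_mul_left]
  refine binomialAvg_mono fun c => ?_
  by_cases ha : a ∈ s <;> by_cases hc : c ∈ t
  · simp [ha, hc, Set.add_mem_add ha hc]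
  all_goals simp [ha, hc, Set.indicator_nonneg]

theorem binomialProb_le_pow_le (n s : ℕ) (w : ℝ) :
    binomialProb n {k | (k : ℝ) ≤ w} ^ s ≤ binomialProb (s * n) {k | (k : ℝ) ≤ s * w} := by
  induction s with
  | zero => simp [binomialProb]
  | succ s ih =>
    rw [pow_succ, Nat.succ_mul]
    refine (mul_le_mul_of_nonneg_right ih (binomialProb_nonneg _ _)).trans <|
      (binomialProb_mul_le_binomialProb_add _ _ _ _).trans <| binomialProb_mono ?_
    rintro _ ⟨a, ha, c, hc, rfl⟩
    simp only [Set.mem_ofPred_eq] at ha hc ⊢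
    push_cast
    linarith

end Binomial

section Count

variable {ι : Type*} [DecidableEq ι]

theorem sublistAvg_prod_count (l : List ι) (S : Finset ι) (g : ι → ℕ → ℝ) :
    sublistAvg l (fun σ => ∏ i ∈ S, g i (σ.count i)) = ∏ i ∈ S, binomialAvg (l.count i) (g i) := by
  induction l generalizing g with
  | nil => simp
  | cons v l ih =>
    by_cases hv : v ∈ S
    · set g' := Function.update g v fun k => g v (k + 1)
      have hne : ∀ i ∈ S.erase v, i ≠ v := fun i hi => Finset.ne_of_mem_erase hi
      have hshift (σ : List ι) : ∏ i ∈ S, g i ((v :: σ).count i) = ∏ i ∈ S, g' i (σ.count i) := by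
        refine Finset.prod_congr rfl fun i _ => ?_
        obtain rfl | hi := eq_or_ne i v <;> simp [g', List.count_cons_of_ne, *, Ne.symm]
      have hg' : ∏ i ∈ S.erase v, binomialAvg (l.count i) (g' i) =
          ∏ i ∈ S.erase v, binomialAvg (l.count i) (g i) :=
        Finset.prod_congr rfl fun i hi => by simp only [g', Function.update_of_ne (hne i hi)]
      have hg'v : g' v = fun k => g v (k + 1) := Function.update_self ..
      have hl : ∏ i ∈ S.erase v, binomialAvg ((v :: l).count i) (g i) =
          ∏ i ∈ S.erase v, binomialAvg (l.count i) (g i) :=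
        Finset.prod_congr rfl fun i hi => by rw [List.count_cons_of_ne (hne i hi).symm]
      simp only [sublistAvg_cons, hshift, ih]
      rw [← Finset.mul_prod_erase S _ hv, ← Finset.mul_prod_erase S _ hv,
        ← Finset.mul_prod_erase S _ hv, hg', hg'v, hl, List.count_cons_self, binomialAvg_succ]
      ring
    · have hcount (σ : List ι) : ∀ i ∈ S, (v :: σ).count i = σ.count i := fun i hi =>
        List.count_cons_of_ne (ne_of_mem_of_not_mem hi hv).symm
      have hshift (σ : List ι) : ∏ i ∈ S, g i ((v :: σ).count i) = ∏ i ∈ S, g i (σ.count i) :=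
        Finset.prod_congr rfl fun i hi => by rw [hcount σ i hi]
      simp only [sublistAvg_cons, hshift, ih, add_self_div_two]
      exact Finset.prod_congr rfl fun i hi => by rw [hcount l i hi]

theorem sublistAvg_count (l : List ι) (i : ι) (g : ℕ → ℝ) :
    sublistAvg l (fun σ => g (σ.count i)) = binomialAvg (l.count i) g := by
  simpa using sublistAvg_prod_count l {i} fun _ => g

theorem sublistProb_forall_count (l : List ι) (S : Finset ι) (s : ι → Set ℕ) :
    sublistProb l {σ | ∀ i ∈ S, σ.count i ∈ s i} = ∏ i ∈ S, binomialProb (l.count i) (s i) := by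
  have hinter : {σ : List ι | ∀ i ∈ S, σ.count i ∈ s i} = ⋂ i ∈ S, {σ | σ.count i ∈ s i} := by
    ext σ
    simp
  simp only [sublistProb, binomialProb, ← sublistAvg_prod_count, hinter]
  congr 1 with σ
  exact (one_pow (M := List ι → ℝ) S.card ▸ prod_indicator_const_apply S _ 1 σ).symm

theorem sublistProb_count_and_exists_count {l : List ι} {u : ι} {S : Finset ι} (hu : u ∉ S)
    (s t : Set ℕ) :
    sublistProb l {σ | σ.count u ∈ s ∧ ∃ i ∈ S, σ.count i ∈ t} =
      binomialProb (l.count u) s * (1 - ∏ i ∈ S, (1 - binomialProb (l.count i) t)) := by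
  set E : Set (List ι) := {σ | σ.count u ∈ s}
  set E' : Set (List ι) := {σ | σ.count u ∈ s ∧ ∀ i ∈ S, σ.count i ∈ tᶜ}
  have hE : sublistProb l E = binomialProb (l.count u) s := by
    simpa using sublistProb_forall_count l {u} fun _ => s
  have hE' : sublistProb l E' =
      binomialProb (l.count u) s * ∏ i ∈ S, (1 - binomialProb (l.count i) t) := by
    have h := sublistProb_forall_count l (insert u S) (Function.update (fun _ => tᶜ) u s)
    have hne : ∀ i ∈ S, i ≠ u := fun i hi => ne_of_mem_of_not_mem hi hu
    rw [Finset.prod_insert hu, Function.update_self,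
      Finset.prod_congr rfl fun i hi => by
        rw [Function.update_of_ne (hne i hi), binomialProb_compl]] at h
    rw [← h]
    congr 1 with σ
    simp +contextual [E', hne, Function.update_of_ne]
  rw [mul_sub, mul_one, ← hE', ← hE, ← sublistProb_diff fun σ hσ => hσ.1]
  congr 1 with σ
  simp only [E, E', Set.mem_sdiff, Set.mem_ofPred_eq, Set.mem_compl_iff, not_and, not_forall,
    not_not, exists_prop]
  tauto

end Count

section BinomialTail

theorem binomialAvg_reflect (n : ℕ) (φ : ℝ → ℝ) :
    binomialAvg n (fun k => φ (n - k)) = binomialAvg n fun k => φ k := by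
  induction n generalizing φ with
  | zero => simp
  | succ n ih =>
    have hkeep : binomialAvg n (fun k => φ (↑(n + 1) - ↑(k + 1))) = binomialAvg n fun k => φ k := by
      simpa using ih φ
    have hdrop : binomialAvg n (fun k => φ (↑(n + 1) - k)) = binomialAvg n fun k => φ ↑(k + 1) := by
      simpa [add_sub_right_comm] using ih fun y => φ (y + 1)
    rw [binomialAvg_succ, binomialAvg_succ, hkeep, hdrop, add_comm]

theorem binomialAvg_centered_succ (n : ℕ) (φ : ℝ → ℝ) :
    binomialAvg (n + 1) (fun k => φ (2 * k - ↑(n + 1))) =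
      (binomialAvg n (fun k => φ (2 * k - n - 1)) +
        binomialAvg n fun k => φ (2 * k - n + 1)) / 2 := by
  rw [binomialAvg_succ]
  congr! 5 with k k <;> push_cast <;> ring

theorem binomialAvg_centered_sq (n : ℕ) (c : ℝ) :
    binomialAvg n (fun k => (2 * k - n + c) ^ 2) = n + c ^ 2 := by
  induction n generalizing c with
  | zero => simp
  | succ n ih =>
    rw [binomialAvg_centered_succ n fun y => (y + c) ^ 2]
    simp only [add_assoc, sub_eq_add_neg] at ih ⊢
    rw [ih, ih]
    push_cast
    ring

theorem binomialAvg_centered_pow_four (n : ℕ) (c : ℝ) :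
    binomialAvg n (fun k => (2 * k - n + c) ^ 4) =
      c ^ 4 + 6 * c ^ 2 * n + 3 * n ^ 2 - 2 * n := by
  induction n generalizing c with
  | zero => simp
  | succ n ih =>
    rw [binomialAvg_centered_succ n fun y => (y + c) ^ 4]
    simp only [add_assoc, sub_eq_add_neg] at ih ⊢
    rw [ih, ih]
    push_cast
    ring

theorem one_quarter_le_binomialProb_sq (n : ℕ) :
    1 / 4 ≤ binomialProb n {k | (n : ℝ) / 16 ≤ (2 * k - n) ^ 2} := by
  set A : Set ℕ := {k | (n : ℝ) / 16 ≤ (2 * k - n) ^ 2}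
  obtain rfl | hn := n.eq_zero_or_pos
  · norm_num [binomialProb, A]
  -- Paley–Zygmund: a quadratic polynomial in the square of the centred variable, positive only
  -- where that square is large, has a positive mean by the second and fourth moments.
  have hpointwise (k : ℕ) : 97 / 16 * n * (2 * k - n : ℝ) ^ 2 - (2 * k - n : ℝ) ^ 4 -
      3 / 8 * n ^ 2 ≤ 9 * n ^ 2 * A.indicator 1 k := by
    by_cases hk : k ∈ A
    · rw [Set.indicator_of_mem hk, Pi.one_apply]
      nlinarith only [sq_nonneg ((2 * k - n : ℝ) ^ 2 - 97 / 32 * n), sq_nonneg (n : ℝ)]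
    · rw [Set.indicator_of_notMem hk]
      have hlt : (2 * k - n : ℝ) ^ 2 < n / 16 := not_le.1 hk
      nlinarith only [hlt, sq_nonneg (2 * k - n : ℝ), Nat.cast_nonneg (α := ℝ) n]
  have hmoments := binomialAvg_mono (n := n) hpointwise
  have hsq := binomialAvg_centered_sq n 0
  have hfour := binomialAvg_centered_pow_four n 0
  simp only [add_zero] at hsq hfour
  simp only [binomialAvg_sub, binomialAvg_mul_left, binomialAvg_const, hsq, hfour] at hmoments
  change _ ≤ 9 * n ^ 2 * binomialProb n A at hmoments
  have hn' : (0 : ℝ) < n ^ 2 := by positivity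
  nlinarith only [hmoments, hn', Nat.cast_nonneg (α := ℝ) n]

theorem binomialProb_reflect (n : ℕ) (s : Set ℝ) :
    binomialProb n {k | (n - k : ℝ) ∈ s} = binomialProb n {k | (k : ℝ) ∈ s} :=
  binomialAvg_reflect n (s.indicator 1)

theorem one_eighth_le_binomialProb_lower (n : ℕ) :
    1 / 8 ≤ binomialProb n {k | (k : ℝ) ≤ n / 2 - √n / 8} := by
  have hreflect := binomialProb_reflect n (Set.Iic (n / 2 - √n / 8))
  have hsubset : {k : ℕ | (n : ℝ) / 16 ≤ (2 * k - n) ^ 2} ⊆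
      {k : ℕ | (n - k : ℝ) ∈ Set.Iic (n / 2 - √n / 8)} ∪
        {k : ℕ | (k : ℝ) ∈ Set.Iic (n / 2 - √n / 8)} := by
    intro k hk
    have hk' : (√n / 4) ^ 2 ≤ (2 * k - n) ^ 2 := by
      rw [div_pow, Real.sq_sqrt n.cast_nonneg]
      norm_num1
      exact hk
    obtain h | h := le_abs.1 ((le_abs_self _).trans (sq_le_sq.1 hk'))
    · left
      simp only [Set.mem_ofPred_eq, Set.mem_Iic]
      linarith
    · right
      simp only [Set.mem_ofPred_eq, Set.mem_Iic]
      linarith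
  have hunion := (binomialProb_mono hsubset).trans (binomialProb_union_le n _ _)
  change _ ≤ binomialProb n {k : ℕ | (k : ℝ) ∈ Set.Iic (n / 2 - √n / 8)}
  linarith [one_quarter_le_binomialProb_sq n]

theorem half_le_binomialProb_upper (n : ℕ) :
    1 / 2 ≤ binomialProb n {k | (n : ℝ) / 2 ≤ k} := by
  have hreflect := binomialProb_reflect n (Set.Ici (n / 2))
  have hcover : {k : ℕ | (k : ℝ) ∈ Set.Ici ((n : ℝ) / 2)}ᶜ ⊆
      {k : ℕ | (n - k : ℝ) ∈ Set.Ici ((n : ℝ) / 2)} := by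
    intro k hk
    simp only [Set.mem_compl_iff, Set.mem_ofPred_eq, Set.mem_Ici] at hk ⊢
    linarith
  have hcompl := binomialProb_compl n {k : ℕ | (k : ℝ) ∈ Set.Ici ((n : ℝ) / 2)}
  change _ ≤ binomialProb n {k : ℕ | (k : ℝ) ∈ Set.Ici ((n : ℝ) / 2)}
  linarith [binomialProb_mono (n := n) hcover]

end BinomialTail

section RankedSum

open scoped Finset

variable {ι α : Type*} [LinearOrder α]

theorem sum_one_div_rank_sq_le (s : Finset ι) (f : ι → α) :
    ∑ i ∈ s, 1 / ((#{j ∈ s | f i ≤ f j} : ℝ) + 1) ^ 2 ≤ 1 - 1 / ((#s : ℝ) + 1) := by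
  classical
  induction s using Finset.induction_on_min_value f with
  | empty => simp
  | insert a s ha hmin ih =>
    have hrank : ∀ i ∈ s, 1 / ((#{j ∈ insert a s | f i ≤ f j} : ℝ) + 1) ^ 2 ≤
        1 / ((#{j ∈ s | f i ≤ f j} : ℝ) + 1) ^ 2 := fun i _ => by
      have := Finset.card_le_card (Finset.filter_subset_filter (fun j => f i ≤ f j)
        (Finset.subset_insert a s))
      gcongr
    have hrank_min : {j ∈ insert a s | f a ≤ f j} = insert a s :=
      Finset.filter_true_of_mem fun j hj =>
        (Finset.mem_insert.1 hj).elim (fun h => h ▸ le_rfl) (hmin j)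
    have htelescope : 1 / ((#s : ℝ) + 1 + 1) ^ 2 ≤ 1 / (#s + 1) - 1 / (#s + 1 + 1) := by
      rw [div_sub_div _ _ (by positivity) (by positivity),
        div_le_div_iff₀ (by positivity) (by positivity)]
      nlinarith [(#s).cast_nonneg (α := ℝ)]
    rw [Finset.sum_insert ha, hrank_min, Finset.card_insert_of_notMem ha]
    push_cast
    linarith [Finset.sum_le_sum hrank]

theorem exists_sum_le_rank_sq_mul {s : Finset ι} (hs : s.Nonempty) (f : ι → ℝ)
    (hf : ∀ i ∈ s, 0 ≤ f i) :
    ∃ k ∈ s, ∑ i ∈ s, f i ≤ ((#{i ∈ s | f k ≤ f i} : ℝ) + 1) ^ 2 * f k := by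
  obtain ⟨k, hk, hmax⟩ :=
    s.exists_max_image (fun i => ((#{j ∈ s | f i ≤ f j} : ℝ) + 1) ^ 2 * f i) hs
  set M := ((#{i ∈ s | f k ≤ f i} : ℝ) + 1) ^ 2 * f k
  have hM : 0 ≤ M := mul_nonneg (by positivity) (hf k hk)
  refine ⟨k, hk, ?_⟩
  calc ∑ i ∈ s, f i ≤ ∑ i ∈ s, M * (1 / ((#{j ∈ s | f i ≤ f j} : ℝ) + 1) ^ 2) :=
        Finset.sum_le_sum fun i hi => by
          rw [mul_one_div, le_div_iff₀' (by positivity)]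
          exact hmax i hi
    _ = M * ∑ i ∈ s, 1 / ((#{j ∈ s | f i ≤ f j} : ℝ) + 1) ^ 2 := (Finset.mul_sum ..).symm
    _ ≤ M * 1 := by
      gcongr
      exact (sum_one_div_rank_sq_le s f).trans (sub_le_self _ (by positivity))
    _ = M := mul_one M

end RankedSum

section BlockCount

theorem exists_blockLength {R s : ℝ} (hs : 0 < s) (hsR : s ≤ 10 * R) :
    ∃ B : ℕ, 0 < B ∧ 32 * R ≤ s * √(B : ℝ) ∧ s ^ 2 * B ≤ 1124 * R ^ 2 := by
  have hR : 0 < R := by linarith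
  refine ⟨⌈(32 * R / s) ^ 2⌉₊, Nat.ceil_pos.2 (by positivity), ?_, ?_⟩
  · rw [← div_le_iff₀' hs]
    exact Real.le_sqrt_of_sq_le (Nat.le_ceil _)
  · calc s ^ 2 * ⌈(32 * R / s) ^ 2⌉₊ ≤ s ^ 2 * ((32 * R / s) ^ 2 + 1) := by
          gcongr
          exact (Nat.ceil_lt_add_one (by positivity)).le
      _ = 1024 * R ^ 2 + s ^ 2 := by field_simp; ring
      _ ≤ 1024 * R ^ 2 + (10 * R) ^ 2 := by gcongr
      _ = 1124 * R ^ 2 := by ring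

theorem exp_neg_div_eight_le_pow_floor {y : ℝ} (hy : 0 ≤ y) :
    Real.exp (-(3 * y)) / 8 ≤ (1 / 8) ^ (⌊y⌋₊ + 1) := by
  have hexp : Real.exp (-3) ≤ 1 / 8 := by
    have h : (2 : ℝ) ^ 3 ≤ Real.exp 1 ^ 3 :=
      pow_le_pow_left₀ two_pos.le Real.exp_one_gt_two.le 3
    rw [← Real.exp_nat_mul] at h
    rw [Real.exp_neg, ← one_div]
    exact one_div_le_one_div_of_le (by norm_num) (by norm_num at h ⊢; exact h)
  rw [pow_succ, ← mul_one_div]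
  refine mul_le_mul_of_nonneg_right ?_ (by norm_num)
  calc Real.exp (-(3 * y)) ≤ Real.exp (⌊y⌋₊ * (-3)) :=
        Real.exp_le_exp.2 (by linarith [Nat.floor_le hy])
    _ = Real.exp (-3) ^ ⌊y⌋₊ := Real.exp_nat_mul _ _
    _ ≤ (1 / 8) ^ ⌊y⌋₊ := by gcongr

theorem log_one_add_sq_mul_exp_le {m t : ℝ} (hm : 0 ≤ m) :
    Real.log (1 + (m + 1) ^ 2 * Real.exp (-t)) ≤ Real.exp (2 * Real.log (m + 1) - t) := by
  have hexp : Real.exp (2 * Real.log (m + 1) - t) = (m + 1) ^ 2 * Real.exp (-t) := by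
    rw [sub_eq_add_neg, Real.exp_add, ← Nat.cast_ofNat, Real.exp_nat_mul,
      Real.exp_log (by positivity)]
  rw [hexp]
  linarith [Real.log_le_sub_one_of_pos (by positivity : 0 < 1 + (m + 1) ^ 2 * Real.exp (-t))]

theorem log_one_add_sq_mul_exp_le_three_mul_log {m t : ℝ} (hm : 1 ≤ m) (ht : 0 ≤ t) :
    Real.log (1 + (m + 1) ^ 2 * Real.exp (-t)) ≤ 3 * Real.log (m + 1) := by
  have hexp : Real.exp (-t) ≤ 1 := Real.exp_le_one_iff.2 (neg_nonpos.2 ht)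
  calc Real.log (1 + (m + 1) ^ 2 * Real.exp (-t)) ≤ Real.log ((m + 1) ^ 3) :=
        Real.log_le_log (by positivity) (by nlinarith [sq_nonneg (m + 1)])
    _ = 3 * Real.log (m + 1) := by rw [Real.log_pow, Nat.cast_ofNat]

theorem exists_blocks_of_le_log {ρ R x : ℝ} {m : ℕ} (hρ₀ : 0 < ρ) (hρ : ρ ≤ 1 / 10 ^ 6)
    (hm : 1 ≤ m) (hR : 1 ≤ R) (hLR : Real.log (m + 1) ≤ 24 * R) (hx₀ : 0 ≤ x)
    (hx : x ≤ 3 * ρ * Real.log (m + 1)) :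
    ∃ s : ℕ, 0 < s ∧ s ≤ 10 * R ∧ 562 * x ≤ s ∧
      ρ * Real.log (1 + (m + 1) ^ 2 * Real.exp (-(ρ⁻¹ * x))) ≤
        s / 2248 * min 1 (m * (1 / 8 : ℝ) ^ s) := by
  have hm' : (1 : ℝ) ≤ m := Nat.one_le_cast.2 hm
  set L := Real.log (m + 1)
  have hL : 0 ≤ L := Real.log_nonneg (by linarith)
  set s := ⌊L / 3⌋₊ + 1 with hs
  have hs_le : (s : ℝ) ≤ L / 3 + 1 := by
    rw [hs, Nat.cast_succ]
    linarith [Nat.floor_le (by positivity : 0 ≤ L / 3)]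
  have hs_ge : L / 3 ≤ s := by
    rw [hs, Nat.cast_succ]
    exact (Nat.lt_floor_add_one _).le
  have hρL : ρ * L ≤ 1 / 10 ^ 6 * L := mul_le_mul_of_nonneg_right hρ hL
  refine ⟨s, Nat.succ_pos _, by linarith, by linarith, ?_⟩
  have hmin : 1 / 16 ≤ min 1 (m * (1 / 8 : ℝ) ^ s) := by
    refine le_min (by norm_num) ?_
    have hpow := exp_neg_div_eight_le_pow_floor (by positivity : 0 ≤ L / 3)
    rw [mul_div_cancel₀ _ three_ne_zero, Real.exp_neg, Real.exp_log (by positivity)] at hpow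
    calc (1 / 16 : ℝ) ≤ m * (((m : ℝ) + 1)⁻¹ / 8) := by
          rw [inv_eq_one_div, div_div, mul_one_div, div_le_div_iff₀ (by norm_num) (by positivity)]
          linarith
      _ ≤ m * (1 / 8) ^ s := by gcongr
  calc ρ * Real.log (1 + (m + 1) ^ 2 * Real.exp (-(ρ⁻¹ * x))) ≤ ρ * (3 * L) := by
        gcongr
        exact log_one_add_sq_mul_exp_le_three_mul_log hm' (by positivity)
    _ ≤ L / 3 / 2248 * (1 / 16) := by linarith
    _ ≤ s / 2248 * min 1 (m * (1 / 8 : ℝ) ^ s) := by gcongr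

theorem exists_blocks_of_log_le {ρ R x : ℝ} {m : ℕ} (hρ₀ : 0 < ρ) (hρ : ρ ≤ 1 / 10 ^ 6)
    (hm : 1 ≤ m) (hR : 1 ≤ R) (hxR : x ≤ R / 100) (hx : 3 * ρ * Real.log (m + 1) ≤ x) :
    ∃ s : ℕ, 0 < s ∧ s ≤ 10 * R ∧ 562 * x ≤ s ∧
      ρ * Real.log (1 + (m + 1) ^ 2 * Real.exp (-(ρ⁻¹ * x))) ≤
        s / 2248 * min 1 (m * (1 / 8 : ℝ) ^ s) := by
  have hm' : (1 : ℝ) ≤ m := Nat.one_le_cast.2 hm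
  set L := Real.log (m + 1)
  have hL : 0 ≤ L := Real.log_nonneg (by linarith)
  have hx₀ : 0 ≤ x := le_trans (by positivity) hx
  set s := ⌊562 * x⌋₊ + 1 with hs
  have hs_le : (s : ℝ) ≤ 562 * x + 1 := by
    rw [hs, Nat.cast_succ]
    linarith [Nat.floor_le (by positivity : 0 ≤ 562 * x)]
  have hs_ge : 562 * x ≤ s := by
    rw [hs, Nat.cast_succ]
    exact (Nat.lt_floor_add_one _).le
  have hs_one : (1 : ℝ) ≤ s := Nat.one_le_cast.2 (Nat.succ_pos _)
  refine ⟨s, Nat.succ_pos _, by linarith, hs_ge, ?_⟩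
  have hmin : Real.exp (-(3 * (562 * x))) / 8 ≤ min 1 (m * (1 / 8 : ℝ) ^ s) :=
    (exp_neg_div_eight_le_pow_floor (by positivity)).trans <|
      le_min (pow_le_one₀ (by norm_num) (by norm_num)) (le_mul_of_one_le_left (by positivity) hm')
  have hexponent : 2 * L - ρ⁻¹ * x ≤ -(3 * (562 * x)) := by
    have hinv : 10 ^ 6 ≤ ρ⁻¹ := by
      rw [le_inv_comm₀ (by norm_num) hρ₀, inv_eq_one_div]
      exact hρ
    have hLx : 3 * L ≤ ρ⁻¹ * x := by
      rw [← div_eq_inv_mul, le_div_iff₀ hρ₀]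
      linarith
    nlinarith
  calc ρ * Real.log (1 + (m + 1) ^ 2 * Real.exp (-(ρ⁻¹ * x)))
      ≤ ρ * Real.exp (-(3 * (562 * x))) := by
        gcongr
        exact (log_one_add_sq_mul_exp_le (by positivity)).trans (Real.exp_le_exp.2 hexponent)
    _ ≤ 1 / 2248 * (Real.exp (-(3 * (562 * x))) / 8) := by
        rw [← mul_div_assoc, mul_div_right_comm]
        gcongr
        linarith
    _ ≤ s / 2248 * min 1 (m * (1 / 8 : ℝ) ^ s) := by gcongr

end BlockCount

section RepeatedTrials

theorem one_sub_pow_le_one_div {p : ℝ} (n : ℕ) (h₀ : 0 ≤ p) (h₁ : p ≤ 1) :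
    (1 - p) ^ n ≤ 1 / (1 + n * p) := by
  have hexp : 1 + n * p ≤ Real.exp (n * p) := by linarith [Real.add_one_le_exp (n * p)]
  calc (1 - p) ^ n ≤ Real.exp (-p) ^ n :=
        pow_le_pow_left₀ (sub_nonneg.2 h₁) (Real.one_sub_le_exp_neg p) n
    _ = 1 / Real.exp (n * p) := by rw [← Real.exp_nat_mul, mul_neg, Real.exp_neg, one_div]
    _ ≤ 1 / (1 + n * p) := one_div_le_one_div_of_le (by positivity) hexp

theorem min_one_mul_div_two_le_one_sub_pow {p : ℝ} (n : ℕ) (h₀ : 0 ≤ p) (h₁ : p ≤ 1) :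
    min 1 (n * p) / 2 ≤ 1 - (1 - p) ^ n := by
  set x : ℝ := n * p
  have hx : 0 ≤ x := by positivity
  have hmin : min 1 x / 2 ≤ 1 - 1 / (1 + x) := by
    rw [one_sub_div (by positivity), add_sub_cancel_left, le_div_iff₀ (by positivity)]
    obtain h | h := le_total 1 x
    · rw [min_eq_left h]; linarith
    · rw [min_eq_right h]; nlinarith
  linarith [one_sub_pow_le_one_div n h₀ h₁]

end RepeatedTrials

section Rounds

theorem tsum_ofMultiset_mul {α : Type*} (s : Multiset α) (hs : s ≠ 0) (F : α → ℝ≥0∞) :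
    ∑' a, PMF.ofMultiset s hs a * F a = (s.map F).sum / s.card := by
  classical
  have hsupport : ∀ a ∉ s.toFinset, PMF.ofMultiset s hs a * F a = 0 := fun a ha => by
    rw [PMF.ofMultiset_apply_of_notMem hs (by simpa using ha), zero_mul]
  rw [tsum_eq_sum hsupport, Finset.sum_multiset_map_count, ENNReal.div_eq_inv_mul, Finset.mul_sum]
  refine Finset.sum_congr rfl fun a _ => ?_
  rw [PMF.ofMultiset_apply, nsmul_eq_mul, ENNReal.div_eq_inv_mul, mul_assoc]

theorem ofReal_sum_map {α : Type*} {F : α → ℝ} (hF : ∀ a, 0 ≤ F a) (l : List α) :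
    ENNReal.ofReal (l.map F).sum = (l.map fun a => ENNReal.ofReal (F a)).sum := by
  induction l with
  | nil => simp
  | cons a l ih =>
    have hl : 0 ≤ (l.map F).sum := List.sum_nonneg <| by simpa using fun a _ => hF a
    rw [List.map_cons, List.sum_cons, ENNReal.ofReal_add (hF a) hl, ih, List.map_cons,
      List.sum_cons]

/-- The list `0, …, b - 1` repeated `K` times: the coins tossed in `K` rounds. -/
def roundList (b K : ℕ) : List (Fin b) :=
  (List.replicate K (List.finRange b)).flatten

theorem roundList_succ (b K : ℕ) : roundList b (K + 1) = List.finRange b ++ roundList b K := by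
  simp [roundList, List.replicate_succ]

theorem count_roundList (b K : ℕ) (i : Fin b) : (roundList b K).count i = K := by
  simp [roundList, List.count_flatten,
    List.count_eq_one_of_mem (List.nodup_finRange b) (List.mem_finRange i)]

end Rounds

namespace UMTS

variable {b : ℕ} (U : UMTS b)

section Offline

theorem d_nonneg (i j : Fin b) : 0 ≤ U.d i j :=
  let := U.metric
  dist_nonneg

theorem d_self (i : Fin b) : U.d i i = 0 :=
  U.metric.dist_self i

theorem diam_nonneg : 0 ≤ U.diam :=
  let := U.metric
  Metric.diam_nonneg

variable {U} in
theorem IsUniform.diam_eq [Nontrivial (Fin b)] {Δ : ℝ} (h : U.IsUniform Δ) : U.diam = Δ := by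
  let := U.metric
  obtain ⟨i, j, hij⟩ := exists_pair_ne (Fin b)
  apply le_antisymm
  · refine Metric.diam_le_of_forall_dist_le (h i j hij ▸ dist_nonneg) fun x _ y _ => ?_
    obtain rfl | hxy := eq_or_ne x y
    · rw [dist_self, ← h i j hij]
      exact dist_nonneg
    · exact (h x y hxy).le
  · rw [← h i j hij]
    exact Metric.dist_le_diam_of_mem (Set.toFinite _).isBounded (Set.mem_univ _) (Set.mem_univ _)

variable {U} in
theorem IsUniform.diam_pos [Nontrivial (Fin b)] (h : U.IsUniform U.diam) : 0 < U.diam := by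
  let := U.metric
  obtain ⟨i, j, hij⟩ := exists_pair_ne (Fin b)
  exact h i j hij ▸ dist_pos.2 hij

theorem offlineCost_cons (c : TaskVec b) (τ : List (TaskVec b)) (p : ℕ → Fin b) :
    U.offlineCost (c :: τ) p =
      U.d (p 0) (p 1) + c (p 1) + U.offlineCost τ fun t => p (t + 1) :=
  Fin.sum_univ_succ _

theorem offlineCost_const (τ : List (TaskVec b)) (u : Fin b) :
    U.offlineCost τ (fun _ => u) = (τ.map fun c => (c u : ℝ)).sum := by
  induction τ with
  | nil => simp [offlineCost]
  | cons c τ ih => simp [offlineCost_cons, ih, d_self]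

theorem offlineCost_nonneg (τ : List (TaskVec b)) (p : ℕ → Fin b) : 0 ≤ U.offlineCost τ p :=
  Finset.sum_nonneg fun _ _ => add_nonneg (U.d_nonneg _ _) (NNReal.coe_nonneg _)

theorem opt0_nonneg (τ : List (TaskVec b)) (u : Fin b) : 0 ≤ U.opt0 τ u :=
  Real.iInf_nonneg fun p => add_nonneg (U.offlineCost_nonneg τ p.1) (U.d_nonneg _ _)

theorem opt0_le (τ : List (TaskVec b)) (p : ℕ → Fin b) :
    U.opt0 τ (p 0) ≤ U.offlineCost τ p + U.d (p τ.length) (p 0) :=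
  ciInf_le (f := fun q : {q : ℕ → Fin b // q 0 = p 0} =>
      U.offlineCost τ q.1 + U.d (q.1 τ.length) (p 0))
    ⟨0, by
      rintro _ ⟨q, rfl⟩
      exact add_nonneg (U.offlineCost_nonneg τ q.1) (U.d_nonneg _ _)⟩ ⟨p, rfl⟩

theorem opt0_le_stay (τ : List (TaskVec b)) (u : Fin b) :
    U.opt0 τ u ≤ (τ.map fun c => (c u : ℝ)).sum := by
  simpa only [offlineCost_const, d_self, add_zero] using U.opt0_le τ fun _ => u

theorem opt0_le_move (τ : List (TaskVec b)) (u i : Fin b) :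
    U.opt0 τ u ≤ (τ.map fun c => (c i : ℝ)).sum + (U.d u i + U.d i u) := by
  cases τ with
  | nil => exact (U.opt0_le_stay [] u).trans <|
      le_add_of_nonneg_right <| add_nonneg (U.d_nonneg u i) (U.d_nonneg i u)
  | cons c τ =>
    have h := U.opt0_le (c :: τ) fun t => if t = 0 then u else i
    simp only [offlineCost_cons, Nat.add_eq_zero_iff, one_ne_zero, and_false, if_false, if_true,
      List.length_cons, offlineCost_const] at h
    simp only [List.map_cons, List.sum_cons]
    linarith

end Offline

section Online

theorem onlineCost_cons (c : TaskVec b) (τ : List (TaskVec b)) (p : ℕ → Fin b) :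
    U.onlineCost (c :: τ) p = U.distRatio * U.d (p 0) (p 1) + U.costRatio (p 1) * c (p 1) +
      U.onlineCost τ fun t => p (t + 1) :=
  Fin.sum_univ_succ _

theorem onlineCost_nonneg (τ : List (TaskVec b)) (p : ℕ → Fin b) : 0 ≤ U.onlineCost τ p :=
  Finset.sum_nonneg fun _ _ => add_nonneg (mul_nonneg U.distRatio_pos.le (U.d_nonneg _ _))
    (mul_nonneg (U.costRatio_pos _).le (NNReal.coe_nonneg _))

end Online

section Hit

/-- The elementary task at `i` whose online cost is the diameter. -/
noncomputable def hitTask (i : Fin b) : ElementaryTask b :=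
  ⟨i, Real.toNNReal ((U.costRatio i)⁻¹ * U.diam)⟩

theorem hitTask_size (i : Fin b) : ((U.hitTask i).size : ℝ) = (U.costRatio i)⁻¹ * U.diam :=
  Real.coe_toNNReal _ (mul_nonneg (inv_nonneg.2 (U.costRatio_pos i).le) U.diam_nonneg)

/-- The task `hitTask` as a vector of processing costs. -/
noncomputable def hitVec (i : Fin b) : TaskVec b := (U.hitTask i).toTask

theorem hitVec_self (i : Fin b) : (U.hitVec i i : ℝ) = (U.costRatio i)⁻¹ * U.diam := by
  rw [← hitTask_size]
  simp [hitVec, ElementaryTask.toTask, hitTask]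

theorem hitVec_of_ne {i j : Fin b} (h : j ≠ i) : (U.hitVec i j : ℝ) = 0 := by
  simp [hitVec, ElementaryTask.toTask, hitTask, h]

theorem sum_hitVec (σ : List (Fin b)) (i : Fin b) :
    ((σ.map U.hitVec).map fun c => (c i : ℝ)).sum = U.diam * (σ.count i / U.costRatio i) := by
  induction σ with
  | nil => simp
  | cons v σ ih =>
    simp only [List.map_cons, List.sum_cons, ih]
    obtain rfl | h := eq_or_ne i v
    · rw [hitVec_self, List.count_cons_self]
      push_cast
      ring
    · rw [hitVec_of_ne U h, List.count_cons_of_ne h.symm, zero_add]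

theorem opt0_hitVec_le_stay (σ : List (Fin b)) (u : Fin b) :
    U.opt0 (σ.map U.hitVec) u ≤ U.diam * (σ.count u / U.costRatio u) :=
  U.sum_hitVec σ u ▸ U.opt0_le_stay (σ.map U.hitVec) u

variable {U} in
theorem IsUniform.opt0_hitVec_le_move (h : U.IsUniform U.diam) (σ : List (Fin b)) {u i : Fin b}
    (hi : i ≠ u) :
    U.opt0 (σ.map U.hitVec) u ≤ U.diam * (σ.count i / U.costRatio i + 2) := by
  have hmove := U.opt0_le_move (σ.map U.hitVec) u i
  rw [sum_hitVec, h _ _ hi, h _ _ hi.symm] at hmove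
  linarith

/-- The online cost of serving a hit at `v` by moving from `u` to `w`. -/
noncomputable def hitStep (u v w : Fin b) : ℝ :=
  U.distRatio * U.d u w + U.costRatio w * U.hitVec v w

/-- The online cost of a sequence of hits for a player whose position is the function `f` of the
points hit so far. -/
noncomputable def hitCost (f : List (Fin b) → Fin b) (σ : List (Fin b)) : ℝ :=
  U.onlineCost (σ.map U.hitVec) fun t => f (σ.take t)

theorem hitCost_nil (f : List (Fin b) → Fin b) : U.hitCost f [] = 0 := by
  rw [hitCost, onlineCost]
  exact Fin.sum_univ_zero _

theorem hitCost_cons (f : List (Fin b) → Fin b) (v : Fin b) (σ : List (Fin b)) :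
    U.hitCost f (v :: σ) = U.hitStep (f []) v (f [v]) + U.hitCost (fun τ => f (v :: τ)) σ :=
  U.onlineCost_cons _ _ _

theorem algCost_map_hitVec (A : OnlineAlgorithm b) (σ : List (Fin b)) (u : Fin b) :
    U.algCost A (σ.map U.hitVec) u = U.hitCost (fun τ => A.state u (τ.map U.hitVec)) σ := by
  simp only [algCost, hitCost, List.map_take]

theorem hitStep_nonneg (u v w : Fin b) : 0 ≤ U.hitStep u v w :=
  add_nonneg (mul_nonneg U.distRatio_pos.le (U.d_nonneg _ _))
    (mul_nonneg (U.costRatio_pos _).le (NNReal.coe_nonneg _))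

variable {U}

theorem IsUniform.diam_le_hitStep (h : U.IsUniform U.diam) (hs : 1 ≤ U.distRatio)
    {u v w : Fin b} (huvw : u = v ∨ u ≠ w) : U.diam ≤ U.hitStep u v w := by
  obtain rfl | huw := eq_or_ne u w
  · obtain rfl := huvw.resolve_right (not_not.2 rfl)
    rw [hitStep, hitVec_self, d_self, mul_inv_cancel_left₀ (U.costRatio_pos u).ne']
    simp
  · refine le_add_of_le_of_nonneg ?_ (mul_nonneg (U.costRatio_pos _).le (NNReal.coe_nonneg _))
    rw [h u w huw]
    exact le_mul_of_one_le_left U.diam_nonneg hs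

/-- When the coin of the current position is tossed it falls on a hit with probability one half,
and then the player pays the diameter; moving away before that toss costs the diameter as well. -/
theorem IsUniform.le_sublistAvg_append_hitCost (h : U.IsUniform U.diam) (hs : 1 ≤ U.distRatio)
    {l : List (Fin b)} {m : ℝ} (hm : ∀ f, m ≤ sublistAvg l (U.hitCost f))
    (p : List (Fin b)) (f : List (Fin b) → Fin b) :
    m ≤ sublistAvg (p ++ l) (U.hitCost f) ∧
      (f [] ∈ p → m + U.diam / 2 ≤ sublistAvg (p ++ l) (U.hitCost f)) := by
  induction p generalizing f with
  | nil => exact ⟨hm f, fun h => by simp at h⟩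
  | cons v p ih =>
    have hcons : sublistAvg (v :: p ++ l) (U.hitCost f) = (sublistAvg (p ++ l) (U.hitCost f) +
        (U.hitStep (f []) v (f [v]) +
          sublistAvg (p ++ l) (U.hitCost fun τ => f (v :: τ)))) / 2 := by
      simp only [List.cons_append, sublistAvg_cons, hitCost_cons, sublistAvg_add, sublistAvg_const]
    have hstep := U.hitStep_nonneg (f []) v (f [v])
    obtain ⟨hskip, hskip'⟩ := ih f
    obtain ⟨hhit, hhit'⟩ := ih fun τ => f (v :: τ)
    rw [hcons]
    refine ⟨by linarith, fun hf => ?_⟩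
    by_cases hpay : f [] = v ∨ f [] ≠ f [v]
    · linarith [h.diam_le_hitStep hs hpay]
    · obtain ⟨hv, hstay⟩ := not_or.1 hpay
      rw [not_not] at hstay
      have hp : f [] ∈ p := (List.mem_cons.1 hf).resolve_left hv
      linarith [hskip' hp, hhit' (hstay ▸ hp)]

theorem IsUniform.le_sublistAvg_hitCost (h : U.IsUniform U.diam) (hs : 1 ≤ U.distRatio) (K : ℕ)
    (f : List (Fin b) → Fin b) : K / 2 * U.diam ≤ sublistAvg (roundList b K) (U.hitCost f) := by
  induction K generalizing f with
  | zero => simp [roundList, hitCost_nil]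
  | succ K ih =>
    rw [roundList_succ]
    refine le_trans (le_of_eq ?_)
      ((h.le_sublistAvg_append_hitCost hs ih (List.finRange b) f).2 (List.mem_finRange _))
    push_cast
    ring

end Hit

section CoinAdversary

/-- In each of `K` rounds every point is hit with probability one half, independently: the uniform
distribution on the sublists of `roundList b K`, encoded as a multiset. -/
noncomputable def coinAdversary (K : ℕ) : PMF (List (ElementaryTask b)) :=
  PMF.ofMultiset ((roundList b K).sublists'.map (List.map U.hitTask)) <| by
    simpa using List.ne_nil_of_mem (List.mem_sublists'.2 (List.nil_sublist (roundList b K)))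

theorem expectedCost_coinAdversary (K : ℕ) {cost : List (TaskVec b) → ℝ} (h : ∀ τ, 0 ≤ cost τ) :
    expectedCost (U.coinAdversary K) cost =
      ENNReal.ofReal (sublistAvg (roundList b K) fun σ => cost (σ.map U.hitVec)) := by
  have hmap (τ : List (Fin b)) : (τ.map U.hitTask).map ElementaryTask.toTask = τ.map U.hitVec :=
    List.map_map
  rw [expectedCost, coinAdversary, tsum_ofMultiset_mul, sublistAvg,
    ENNReal.ofReal_div_of_pos (by positivity), ofReal_sum_map fun τ => h _,
    ENNReal.ofReal_pow zero_le_two]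
  simp [Function.comp_def, hmap]

theorem size_eq_of_mem_support_coinAdversary {K : ℕ} {σ : List (ElementaryTask b)}
    (hσ : σ ∈ (U.coinAdversary K).support) {e : ElementaryTask b} (he : e ∈ σ) :
    (e.size : ℝ) = (U.costRatio e.point)⁻¹ * U.diam := by
  simp only [coinAdversary, PMF.mem_support_ofMultiset_iff] at hσ
  obtain ⟨τ, -, rfl⟩ : ∃ τ : List (Fin b), τ.Sublist (roundList b K) ∧ τ.map U.hitTask = σ := by
    simpa using hσ
  obtain ⟨i, -, rfl⟩ := List.mem_map.1 he
  exact U.hitTask_size i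

variable {U}

theorem IsUniform.isDiscreteAdversary [Nontrivial (Fin b)] (h : U.IsUniform U.diam)
    (hs : 1 ≤ U.distRatio) {K : ℕ} {r β : ℝ} (hβ : 0 < β) (hr : r * β ≤ K / 2) (u : Fin b)
    (hopt : sublistAvg (roundList b K) (fun σ => U.opt0 (σ.map U.hitVec) u) ≤ β * U.diam) :
    U.IsDiscreteAdversary r β (fun i => (U.costRatio i)⁻¹) (U.coinAdversary K) where
  diam_pos := h.diam_pos
  beta_pos := hβ
  offline_le := (iInf_le _ u).trans <| by
    rw [expectedCost_coinAdversary U K fun τ => U.opt0_nonneg τ u]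
    exact ENNReal.ofReal_le_ofReal hopt
  le_online A := le_iInf fun u₀ => by
    rw [expectedCost_coinAdversary U K (cost := fun σ => U.algCost A σ u₀)
      fun τ => U.onlineCost_nonneg τ _]
    refine ENNReal.ofReal_le_ofReal ?_
    rw [← mul_assoc]
    refine (mul_le_mul_of_nonneg_right hr U.diam_nonneg).trans ?_
    simp only [algCost_map_hitVec]
    exact h.le_sublistAvg_hitCost hs K _
  size_eq _ hσ _ he := U.size_eq_of_mem_support_coinAdversary hσ he

end CoinAdversary

section Saving

/-- `U` admits an `(r, β; r₁⁻¹, …, r_b⁻¹)`-discrete adversary with `β ≤ B`. -/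
def HasDiscreteAdversary (r B : ℝ) : Prop :=
  ∃ β D, U.IsDiscreteAdversary r β (fun i => (U.costRatio i)⁻¹) D ∧ β ≤ B

/-- The hit sequences on which an optimal offline player starting at `u` saves at least the diameter
compared with staying at `u`. -/
def savingEvent (u : Fin b) : Set (List (Fin b)) :=
  {σ | U.opt0 (σ.map U.hitVec) u ≤ U.diam * (σ.count u / U.costRatio u - 1)}

variable {U}

theorem HasDiscreteAdversary.mono {r r' B B' : ℝ} (h : U.HasDiscreteAdversary r B)
    (hr : r' ≤ r) (hB : B ≤ B') : U.HasDiscreteAdversary r' B' := by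
  obtain ⟨β, D, hD, hβ⟩ := h
  have honline : r' * (β * U.diam) ≤ r * (β * U.diam) :=
    mul_le_mul_of_nonneg_right hr (mul_pos hD.beta_pos hD.diam_pos).le
  exact ⟨β, D, { hD with
    le_online := fun A => (ENNReal.ofReal_le_ofReal honline).trans (hD.le_online A) },
    hβ.trans hB⟩

theorem sublistAvg_opt0_le (K : ℕ) (u : Fin b) :
    sublistAvg (roundList b K) (fun σ => U.opt0 (σ.map U.hitVec) u) ≤
      (K / (2 * U.costRatio u) - sublistProb (roundList b K) (U.savingEvent u)) * U.diam := by
  have hpointwise (σ : List (Fin b)) : U.opt0 (σ.map U.hitVec) u ≤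
      U.diam * ((U.costRatio u)⁻¹ * σ.count u - (U.savingEvent u).indicator 1 σ) := by
    rw [inv_mul_eq_div]
    by_cases hσ : σ ∈ U.savingEvent u
    · exact (Set.indicator_of_mem hσ (1 : List (Fin b) → ℝ)).symm ▸ hσ
    · simpa [hσ] using U.opt0_hitVec_le_stay σ u
  refine (sublistAvg_mono fun σ _ => hpointwise σ).trans (le_of_eq ?_)
  rw [sublistAvg_mul_left, sublistAvg_sub, sublistAvg_mul_left,
    sublistAvg_count _ u fun k => (k : ℝ), count_roundList, binomialAvg_cast, sublistProb]
  ring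

theorem IsUniform.mem_savingEvent (h : U.IsUniform U.diam) {u i : Fin b} (hi : i ≠ u)
    {σ : List (Fin b)} (hσ : (σ.count i : ℝ) / U.costRatio i + 3 ≤ σ.count u / U.costRatio u) :
    σ ∈ U.savingEvent u :=
  (h.opt0_hitVec_le_move σ hi).trans
    (mul_le_mul_of_nonneg_left (by linarith) U.diam_nonneg)

variable [Nontrivial (Fin b)]

theorem IsUniform.hasDiscreteAdversary_of_le_savingEvent (h : U.IsUniform U.diam)
    (hs : 1 ≤ U.distRatio) {K : ℕ} (hK : 0 < K) {u : Fin b} {q : ℝ} (hq₀ : 0 ≤ q)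
    (hq : q ≤ sublistProb (roundList b K) (U.savingEvent u)) :
    U.HasDiscreteAdversary (U.costRatio u + 2 * U.costRatio u ^ 2 * q / K)
      (K / (2 * U.costRatio u)) := by
  set R := U.costRatio u
  have hR : 0 < R := U.costRatio_pos u
  set r := R + 2 * R ^ 2 * q / K with hr
  have hRr : R ≤ r := le_add_of_nonneg_right (by positivity)
  have hr₀ : 0 < r := hR.trans_le hRr
  have hoffline : K / (2 * R) - q ≤ K / 2 / r := by
    have hexpand : (K / (2 * R) - q) * r = K / 2 - 2 * R ^ 2 * q ^ 2 / K := by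
      rw [hr]
      field_simp
      ring
    rw [le_div_iff₀ hr₀, hexpand, sub_le_self_iff]
    positivity
  refine ⟨K / 2 / r, _, h.isDiscreteAdversary hs (K := K) (by positivity)
    (mul_div_cancel₀ _ hr₀.ne').le u ?_, ?_⟩
  · refine (sublistAvg_opt0_le K u).trans (mul_le_mul_of_nonneg_right ?_ U.diam_nonneg)
    linarith
  · rw [div_div]
    gcongr

theorem IsUniform.hasDiscreteAdversary_of_le_binomialProb (h : U.IsUniform U.diam)
    (hs : 1 ≤ U.distRatio) {K : ℕ} (hK : 0 < K) {u : Fin b} {S : Finset (Fin b)} (hu : u ∉ S)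
    {Q w p : ℝ} (hQ : 0 < Q) (hS : ∀ i ∈ S, Q ≤ U.costRatio i)
    (hw : w / Q + 3 ≤ K / (2 * U.costRatio u)) (hp₀ : 0 ≤ p)
    (hp : p ≤ binomialProb K {k | (k : ℝ) ≤ w}) :
    U.HasDiscreteAdversary
      (U.costRatio u + U.costRatio u ^ 2 / K * (min 1 (S.card * p) / 2))
      (K / (2 * U.costRatio u)) := by
  set P := binomialProb K {k | (k : ℝ) ≤ w}
  have hsub : {σ : List (Fin b) | σ.count u ∈ {k : ℕ | (K : ℝ) / 2 ≤ k} ∧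
      ∃ i ∈ S, σ.count i ∈ {k : ℕ | (k : ℝ) ≤ w}} ⊆ U.savingEvent u := by
    rintro σ ⟨hσu, i, hi, hσi⟩
    have hw₀ : 0 ≤ w := (Nat.cast_nonneg _).trans hσi
    refine h.mem_savingEvent (ne_of_mem_of_not_mem hi hu) ?_
    calc (σ.count i : ℝ) / U.costRatio i + 3 ≤ w / Q + 3 := by
          gcongr
          · exact hσi
          · exact hS i hi
      _ ≤ K / 2 / U.costRatio u := by rwa [div_div]
      _ ≤ σ.count u / U.costRatio u := div_le_div_of_nonneg_right hσu (U.costRatio_pos u).le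
  have hprob : 1 / 2 * (min 1 (S.card * p) / 2) ≤
      sublistProb (roundList b K) (U.savingEvent u) :=
    calc 1 / 2 * (min 1 (S.card * p) / 2) ≤ 1 / 2 * (min 1 (S.card * P) / 2) := by gcongr
      _ ≤ binomialProb K {k | (K : ℝ) / 2 ≤ k} * (1 - (1 - P) ^ S.card) :=
        mul_le_mul (half_le_binomialProb_upper K)
          (min_one_mul_div_two_le_one_sub_pow _ (hp₀.trans hp) (binomialProb_le_one _ _))
          (by positivity [hp₀.trans hp]) (binomialProb_nonneg _ _)
      _ ≤ sublistProb (roundList b K) (U.savingEvent u) := by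
        refine le_of_eq_of_le ?_ (sublistProb_mono fun σ _ hσ => hsub hσ)
        rw [sublistProb_count_and_exists_count hu]
        simp only [count_roundList, Finset.prod_const, P]
  exact (h.hasDiscreteAdversary_of_le_savingEvent hs hK (by positivity) hprob).mono
    (by apply le_of_eq; ring) le_rfl

end Saving

section Adversaries

variable {U} [Nontrivial (Fin b)]

theorem IsUniform.hasDiscreteAdversary_of_ne (h : U.IsUniform U.diam) (hs : 1 ≤ U.distRatio)
    {u k : Fin b} (hk : k ≠ u) (hR : 1 ≤ U.costRatio u) :
    U.HasDiscreteAdversary (U.costRatio u + Real.exp (-(7 * U.costRatio u)) / 14)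
      (562 * U.costRatio u) := by
  set R := U.costRatio u
  set K := ⌈6 * R⌉₊
  have hK : 0 < K := Nat.ceil_pos.2 (by linarith)
  have hK₆ : 6 * R ≤ K := Nat.le_ceil _
  have hK₇ : (K : ℝ) ≤ 7 * R := by linarith [Nat.ceil_lt_add_one (a := 6 * R) (by linarith)]
  have hnever : (1 / 2 : ℝ) ^ K ≤ binomialProb K {k | (k : ℝ) ≤ 0} :=
    (binomialProb_singleton_zero K).symm.le.trans (binomialProb_mono fun k hk => by simp_all)
  have hexp : Real.exp (-(7 * R)) ≤ (1 / 2) ^ K := by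
    have hhalf : Real.exp (-1) ≤ 1 / 2 := by
      rw [Real.exp_neg, ← one_div]
      exact one_div_le_one_div_of_le two_pos Real.exp_one_gt_two.le
    calc Real.exp (-(7 * R)) ≤ Real.exp (K * (-1)) := Real.exp_le_exp.2 (by linarith)
      _ = Real.exp (-1) ^ K := Real.exp_nat_mul _ _
      _ ≤ (1 / 2) ^ K := by gcongr
  refine (h.hasDiscreteAdversary_of_le_binomialProb hs hK (Finset.notMem_singleton.2 hk.symm)
    (U.costRatio_pos k) (fun i hi => (congrArg U.costRatio (Finset.mem_singleton.1 hi)).ge)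
    (w := 0) ?_ (by positivity) hnever).mono ?_ ?_
  · rw [zero_div, zero_add, le_div_iff₀ (by linarith)]
    linarith
  · have hrate : 1 / 7 ≤ R ^ 2 / K := by
      rw [div_le_div_iff₀ (by norm_num) (by positivity)]
      nlinarith
    have hmin : min 1 ((1 / 2 : ℝ) ^ K) = (1 / 2) ^ K :=
      min_eq_right (pow_le_one₀ (by norm_num) (by norm_num))
    rw [Finset.card_singleton, Nat.cast_one, one_mul, hmin]
    have := mul_le_mul hrate hexp (Real.exp_pos _).le (by positivity)
    linarith
  · rw [div_le_iff₀ (by linarith)]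
    nlinarith

/-- The `K = s B` rounds are cut into `s` blocks of `B ≈ (32 R / s) ^ 2` rounds. With probability at
least `8⁻ˢ` a point is hit `√B / 8` times less often than expected in every block, hence `4 R` times
less often than expected in total. -/
theorem IsUniform.hasDiscreteAdversary_of_blocks (h : U.IsUniform U.diam) (hs : 1 ≤ U.distRatio)
    {u : Fin b} {S : Finset (Fin b)} (hu : u ∉ S) {x : ℝ} (hx : 0 ≤ x) (hxu : x < U.costRatio u)
    (hS : ∀ i ∈ S, U.costRatio u - x ≤ U.costRatio i) {s : ℕ} (hs₀ : 0 < s)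
    (hsR : s ≤ 10 * U.costRatio u) (hxs : 562 * x ≤ s) :
    U.HasDiscreteAdversary (U.costRatio u + s / 2248 * min 1 (S.card * (1 / 8 : ℝ) ^ s))
      (562 * U.costRatio u) := by
  set R := U.costRatio u
  have hR : 0 < R := U.costRatio_pos u
  obtain ⟨B, hB, hsqrt, hBle⟩ := exists_blockLength (Nat.cast_pos.2 hs₀) hsR
  obtain ⟨K, hK⟩ : ∃ K, K = s * B := ⟨_, rfl⟩
  have hK₀ : 0 < K := hK ▸ Nat.mul_pos hs₀ hB
  have hKcast : (K : ℝ) = s * B := by rw [hK, Nat.cast_mul]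
  have hKs : (K : ℝ) * s ≤ 1124 * R ^ 2 := by
    rw [hKcast]
    linarith
  have hs₁ : (1 : ℝ) ≤ s := Nat.one_le_cast.2 hs₀
  have hlower : (1 / 8 : ℝ) ^ s ≤ binomialProb K {k | (k : ℝ) ≤ s * (B / 2 - √B / 8)} :=
    hK ▸ (pow_le_pow_left₀ (by norm_num) (one_eighth_le_binomialProb_lower B) s).trans
      (binomialProb_le_pow_le B s _)
  refine (h.hasDiscreteAdversary_of_le_binomialProb hs hK₀ hu (sub_pos.2 hxu) hS ?_
    (by positivity) hlower).mono ?_ ?_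
  · have hKx : K * x ≤ 2 * R ^ 2 := by nlinarith
    have hrate : (K / 2 - 4 * R) / (R - x) + 3 ≤ K / (2 * R) := by
      rw [← le_sub_iff_add_le, div_le_iff₀ (sub_pos.2 hxu)]
      have : K / (2 * R) * (R - x) = K / 2 - K * x / (2 * R) := by field_simp
      have : K * x / (2 * R) ≤ R := by rw [div_le_iff₀ (by positivity)]; linarith
      linarith
    refine le_trans ?_ hrate
    gcongr
    linarith
  · have hrate : (s : ℝ) / 1124 ≤ R ^ 2 / K := by
      rw [div_le_div_iff₀ (by norm_num) (by positivity)]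
      linarith
    have := mul_le_mul_of_nonneg_right hrate
      (by positivity : 0 ≤ min 1 (S.card * (1 / 8 : ℝ) ^ s) / 2)
    linarith
  · rw [div_le_iff₀ (by positivity)]
    nlinarith

end Adversaries

end UMTS

section LogSumExp

variable {ι : Type*} [Fintype ι] [Nonempty ι]

theorem mul_log_sum_exp_le {ρ : ℝ} (hρ : 0 < ρ) {r : ι → ℝ} {R c : ℝ} (hc : 0 < c)
    (h : ∑ i, Real.exp (ρ⁻¹ * r i) ≤ c * Real.exp (ρ⁻¹ * R)) :
    ρ * Real.log (∑ i, Real.exp (ρ⁻¹ * r i)) ≤ R + ρ * Real.log c := by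
  have hpos : 0 < ∑ i, Real.exp (ρ⁻¹ * r i) :=
    Finset.sum_pos (fun i _ => Real.exp_pos _) Finset.univ_nonempty
  calc ρ * Real.log (∑ i, Real.exp (ρ⁻¹ * r i))
      ≤ ρ * Real.log (c * Real.exp (ρ⁻¹ * R)) :=
        mul_le_mul_of_nonneg_left (Real.log_le_log hpos h) hρ.le
    _ = R + ρ * Real.log c := by
        rw [Real.log_mul hc.ne' (Real.exp_pos _).ne', Real.log_exp, mul_add,
          mul_inv_cancel_left₀ hρ.ne', add_comm]

theorem mul_log_sum_exp_eq {ρ : ℝ} (hρ : ρ ≠ 0) {r n : ι → ℝ} (hn : ∀ i, 0 < n i)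
    (hr : ∀ i, r i = ρ * (1 + Real.log (n i))) :
    ρ * Real.log (∑ i, Real.exp (ρ⁻¹ * r i)) = ρ * (1 + Real.log (∑ i, n i)) := by
  have hexp (i : ι) : Real.exp (ρ⁻¹ * r i) = Real.exp 1 * n i := by
    rw [hr, inv_mul_cancel_left₀ hρ, Real.exp_add, Real.exp_log (hn i)]
  have hsum : 0 < ∑ i, n i := Finset.sum_pos (fun i _ => hn i) Finset.univ_nonempty
  simp only [hexp]
  rw [← Finset.mul_sum, Real.log_mul (Real.exp_pos _).ne' hsum.ne', Real.log_exp]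

end LogSumExp

namespace UMTS

variable {b : ℕ}

theorem mul_sublistProb_forall_count_ne_zero_le_one (u : Fin b) {K : ℕ} (hK : K * 2 ^ K ≤ b) :
    K * sublistProb (roundList b K)
      {σ | ∀ i ∈ Finset.univ.erase u, σ.count i ∈ ({0} : Set ℕ)ᶜ} ≤ 1 := by
  obtain ⟨p, hp_def⟩ : ∃ p : ℝ, p = (1 / 2) ^ K := ⟨_, rfl⟩
  have hp₀ : 0 < p := by rw [hp_def]; positivity
  have hp : p ≤ 1 := by rw [hp_def]; exact pow_le_one₀ (by norm_num) (by norm_num)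
  have hKp : K ≤ b * p := by
    rw [hp_def, one_div_pow, mul_one_div, le_div_iff₀ (by positivity)]
    exact_mod_cast hK
  have hcard : ((b - 1 : ℕ) : ℝ) = b - 1 := Nat.cast_pred (Fin.pos u)
  have hnone : sublistProb (roundList b K)
      {σ | ∀ i ∈ Finset.univ.erase u, σ.count i ∈ ({0} : Set ℕ)ᶜ} = (1 - p) ^ (b - 1) := by
    rw [sublistProb_forall_count _ _ fun _ => {0}ᶜ]
    simp only [count_roundList, binomialProb_compl, binomialProb_singleton_zero,
      Finset.prod_const, Finset.card_erase_of_mem (Finset.mem_univ u), Finset.card_univ,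
      Fintype.card_fin, hp_def]
  have hpos : 0 < 1 + ((b - 1 : ℕ) : ℝ) * p := by positivity
  rw [hnone]
  calc K * (1 - p) ^ (b - 1)
      ≤ K * (1 / (1 + (b - 1 : ℕ) * p)) := by
        gcongr
        exact one_sub_pow_le_one_div _ (by positivity) hp
    _ ≤ 1 := by
        rw [mul_one_div, div_le_one hpos, hcard]
        linarith

variable [Nontrivial (Fin b)] {U : UMTS b}

theorem IsUniform.hasDiscreteAdversary_of_superlevel (h : U.IsUniform U.diam)
    (hs : 1 ≤ U.distRatio) {u k : Fin b} (hR : 1 ≤ U.costRatio u)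
    (hku : U.costRatio k ≤ U.costRatio u) {S : Finset (Fin b)} (hu : u ∉ S) (hk : k ∈ S)
    (hS : ∀ i ∈ S, U.costRatio k ≤ U.costRatio i) (hb : Real.log b ≤ 24 * U.costRatio u)
    {ρ : ℝ} (hρ₀ : 0 < ρ) (hρ : ρ ≤ 1 / 10 ^ 6) :
    U.HasDiscreteAdversary
      (U.costRatio u + ρ * Real.log
        (1 + (S.card + 1) ^ 2 * Real.exp (-(ρ⁻¹ * (U.costRatio u - U.costRatio k)))))
      (562 * U.costRatio u) := by
  set R := U.costRatio u
  obtain ⟨x, hx⟩ : ∃ x, x = R - U.costRatio k := ⟨_, rfl⟩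
  rw [← hx]
  have hx₀ : 0 ≤ x := by linarith
  have hm : 1 ≤ S.card := Finset.card_pos.2 ⟨k, hk⟩
  have hL : Real.log (S.card + 1) ≤ 24 * R := by
    have hcard : S.card + 1 ≤ b := by
      simpa [Finset.card_insert_of_notMem hu] using Finset.card_le_univ (insert u S)
    exact (Real.log_le_log (by positivity) (by exact_mod_cast hcard)).trans hb
  obtain hfar | hnear := lt_or_ge (R / 100) x
  · refine (h.hasDiscreteAdversary_of_ne hs (ne_of_mem_of_not_mem hk hu) hR).mono ?_ le_rfl
    have hinv : 10 ^ 6 * x ≤ ρ⁻¹ * x := by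
      gcongr
      rw [le_inv_comm₀ (by norm_num) hρ₀, inv_eq_one_div]
      exact hρ
    have hlog := (log_one_add_sq_mul_exp_le (m := S.card) (t := ρ⁻¹ * x) (by positivity)).trans
      (Real.exp_le_exp.2 (by linarith : _ ≤ -(7 * R)))
    have := mul_le_mul (by linarith : ρ ≤ 1 / 14) hlog
      (Real.log_nonneg (le_add_of_nonneg_right (by positivity))) (by norm_num)
    linarith
  · obtain ⟨s, hs₀, hsR, hxs, hgain⟩ : ∃ s : ℕ, 0 < s ∧ s ≤ 10 * R ∧ 562 * x ≤ s ∧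
        ρ * Real.log (1 + (S.card + 1) ^ 2 * Real.exp (-(ρ⁻¹ * x))) ≤
          s / 2248 * min 1 (S.card * (1 / 8 : ℝ) ^ s) := by
      obtain hxL | hxL := le_total x (3 * ρ * Real.log (S.card + 1))
      · exact exists_blocks_of_le_log hρ₀ hρ hm hR hL hx₀ hxL
      · exact exists_blocks_of_log_le hρ₀ hρ hm hR hnear hxL
    exact (h.hasDiscreteAdversary_of_blocks hs hu hx₀ (by linarith)
      (fun i hi => by linarith [hS i hi]) hs₀ hsR hxs).mono (by linarith) le_rfl

theorem IsUniform.hasDiscreteAdversary_of_log_le (h : U.IsUniform U.diam) (hs : 1 ≤ U.distRatio)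
    {u : Fin b} (hmax : ∀ i, U.costRatio i ≤ U.costRatio u) (hR : 1 ≤ U.costRatio u)
    (hb : Real.log b ≤ 24 * U.costRatio u) {ρ : ℝ} (hρ₀ : 0 < ρ) (hρ : ρ ≤ 1 / 10 ^ 6) :
    U.HasDiscreteAdversary (ρ * Real.log (∑ i, Real.exp (ρ⁻¹ * U.costRatio i)))
      (562 * U.costRatio u) := by
  set E : Fin b → ℝ := fun i => Real.exp (ρ⁻¹ * U.costRatio i)
  have hne : (Finset.univ.erase u).Nonempty :=
    (exists_ne u).imp fun i hi => Finset.mem_erase.2 ⟨hi, Finset.mem_univ i⟩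
  obtain ⟨k, hk, hsum⟩ := exists_sum_le_rank_sq_mul hne E fun i _ => (Real.exp_pos _).le
  set S := {i ∈ Finset.univ.erase u | E k ≤ E i}
  have hu : u ∉ S := fun hu => by simp [S] at hu
  have hS : ∀ i ∈ S, U.costRatio k ≤ U.costRatio i := fun i hi =>
    le_of_mul_le_mul_left (Real.exp_le_exp.1 (Finset.mem_filter.1 hi).2) (inv_pos.2 hρ₀)
  refine (h.hasDiscreteAdversary_of_superlevel hs hR (hmax k) hu
    (Finset.mem_filter.2 ⟨hk, le_rfl⟩) hS hb hρ₀ hρ).mono ?_ le_rfl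
  refine mul_log_sum_exp_le hρ₀ (by positivity) ?_
  rw [add_mul, one_mul, mul_assoc, ← Real.exp_add,
    show -(ρ⁻¹ * (U.costRatio u - U.costRatio k)) + ρ⁻¹ * U.costRatio u = ρ⁻¹ * U.costRatio k by
      ring, ← Finset.add_sum_erase _ _ (Finset.mem_univ u)]
  gcongr

theorem IsUniform.hasDiscreteAdversary_of_mul_two_pow_le (h : U.IsUniform U.diam)
    (hs : 1 ≤ U.distRatio) {u : Fin b} (hR : 1 ≤ U.costRatio u) {K : ℕ} (hK : K * 2 ^ K ≤ b) :
    U.HasDiscreteAdversary (K / 6) 3 := by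
  set E : Set (List (Fin b)) := {σ | ∀ i ∈ Finset.univ.erase u, σ.count i ∈ ({0} : Set ℕ)ᶜ}
  have hpointwise (σ : List (Fin b)) (hσ : σ.Sublist (roundList b K)) :
      U.opt0 (σ.map U.hitVec) u ≤ U.diam * (2 + K * E.indicator 1 σ) := by
    by_cases hE : σ ∈ E
    · have hcount : (σ.count u : ℝ) / U.costRatio u ≤ K :=
        (div_le_self (Nat.cast_nonneg _) hR).trans <|
          Nat.cast_le.2 ((hσ.count_le u).trans (count_roundList b K u).le)
      rw [Set.indicator_of_mem hE, Pi.one_apply]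
      exact (U.opt0_hitVec_le_stay σ u).trans
        (mul_le_mul_of_nonneg_left (by linarith) U.diam_nonneg)
    · obtain ⟨i, hi, h₀⟩ : ∃ i, i ≠ u ∧ σ.count i = 0 := by simpa [E] using hE
      rw [Set.indicator_of_notMem hE]
      simpa [h₀] using h.opt0_hitVec_le_move σ hi
  have hprob := mul_sublistProb_forall_count_ne_zero_le_one u hK
  rw [sublistProb] at hprob
  refine ⟨3, _, h.isDiscreteAdversary hs (K := K) three_pos (by linarith) u ?_, le_rfl⟩
  refine (sublistAvg_mono hpointwise).trans ?_
  rw [sublistAvg_mul_left, sublistAvg_add, sublistAvg_const, sublistAvg_mul_left, mul_comm]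
  exact mul_le_mul_of_nonneg_right (by linarith) U.diam_nonneg

theorem IsUniform.hasDiscreteAdversary_of_lt_log (h : U.IsUniform U.diam)
    (hs : 1 ≤ U.distRatio) {u : Fin b} (hR : 1 ≤ U.costRatio u)
    (hb : 24 * U.costRatio u < Real.log b) :
    U.HasDiscreteAdversary (U.costRatio u + Real.log b / 32) (562 * U.costRatio u) := by
  set K := ⌊Real.log b / 2⌋₊
  have hK_le : (K : ℝ) ≤ Real.log b / 2 := Nat.floor_le (by linarith)
  have hK_lt : Real.log b / 2 < K + 1 := Nat.lt_floor_add_one _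
  have hK : K * 2 ^ K ≤ b := by
    have hlinear : (K : ℝ) ≤ Real.exp K := by linarith [Real.add_one_le_exp (K : ℝ)]
    have hpow : (2 : ℝ) ^ K ≤ Real.exp K := by
      rw [← mul_one (K : ℝ), Real.exp_nat_mul]
      exact pow_le_pow_left₀ two_pos.le Real.exp_one_gt_two.le K
    have : (K : ℝ) * 2 ^ K ≤ b :=
      calc (K : ℝ) * 2 ^ K ≤ Real.exp K * Real.exp K := by gcongr
        _ = Real.exp (K + K) := (Real.exp_add _ _).symm
        _ ≤ Real.exp (Real.log b) := Real.exp_le_exp.2 (by linarith)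
        _ = b := Real.exp_log (Nat.cast_pos.2 (Fin.pos u))
    exact_mod_cast this
  exact (h.hasDiscreteAdversary_of_mul_two_pow_le hs hR hK).mono (by linarith) (by linarith)

theorem IsUniform.hasDiscreteAdversary (h : U.IsUniform U.diam) (hs : 1 ≤ U.distRatio)
    {u : Fin b} (hmax : ∀ i, U.costRatio i ≤ U.costRatio u) (hR : 1 ≤ U.costRatio u) {ρ : ℝ}
    (hρ₀ : 0 < ρ) (hρ : ρ ≤ 1 / 10 ^ 6) :
    U.HasDiscreteAdversary (ρ * Real.log (∑ i, Real.exp (ρ⁻¹ * U.costRatio i)))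
      (562 * U.costRatio u) := by
  obtain hb | hb := le_or_gt (Real.log b) (24 * U.costRatio u)
  · exact h.hasDiscreteAdversary_of_log_le hs hmax hR hb hρ₀ hρ
  · refine (h.hasDiscreteAdversary_of_lt_log hs hR hb).mono ?_ le_rfl
    have hsum : ∑ i, Real.exp (ρ⁻¹ * U.costRatio i) ≤ b * Real.exp (ρ⁻¹ * U.costRatio u) := by
      simpa using Finset.sum_le_card_nsmul Finset.univ _ _ fun i _ =>
        Real.exp_le_exp.2 (mul_le_mul_of_nonneg_left (hmax i) (inv_pos.2 hρ₀).le)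
    refine (mul_log_sum_exp_le hρ₀ (Nat.cast_pos.2 (Fin.pos u)) hsum).trans ?_
    have : ρ * Real.log b ≤ 1 / 10 ^ 6 * Real.log b :=
      mul_le_mul_of_nonneg_right hρ (Real.log_natCast_nonneg b)
    linarith [Real.log_natCast_nonneg b]

end UMTS

theorem mainTheorem4_general :
    ∃ lam₃ ρ : ℝ, 0 < lam₃ ∧ 0 < ρ ∧
      ∀ (b : ℕ), 2 ≤ b → ∀ (Δ : ℝ) (U : UMTS b), U.IsUniform Δ → 1 ≤ U.distRatio →
        ∀ u, (∀ i, U.costRatio i ≤ U.costRatio u) → 1 ≤ U.costRatio u →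
          ∃ (β : ℝ) (D : PMF (List (ElementaryTask b))),
            U.IsDiscreteAdversary (ρ * Real.log (∑ i, Real.exp (ρ⁻¹ * U.costRatio i))) β
              (fun i => (U.costRatio i)⁻¹) D ∧
            β ≤ lam₃ * U.costRatio u := by
  refine ⟨562, 1 / 10 ^ 6, by norm_num, by norm_num, fun b hb Δ U hU hs u hmax hR => ?_⟩
  have : Nontrivial (Fin b) := Fin.nontrivial_iff_two_le.2 hb
  have h : U.IsUniform U.diam := hU.diam_eq.symm ▸ hU
  exact h.hasDiscreteAdversary hs hmax hR (by norm_num) le_rfl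

theorem mainTheorem4 :
    ∃ lam₃ ρ : ℝ, 0 < lam₃ ∧ 0 < ρ ∧
      ∀ (b : ℕ) (hb : 2 ≤ b) (Δ : ℝ) (U : UMTS b),
        U.IsUniform Δ → U.distRatio = 1 →
        Antitone U.costRatio → (∀ i, 1 ≤ U.costRatio i) →
        ((1 / 4 * Real.log b ≤ U.costRatio ⟨0, by omega⟩ →
            ∃ (r β : ℝ) (D : PMF (List (ElementaryTask b))),
              U.IsDiscreteAdversary r β (fun i => (U.costRatio i)⁻¹) D ∧
              β ≤ lam₃ * U.costRatio ⟨0, by omega⟩ ∧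
              ρ * Real.log (∑ i, Real.exp (ρ⁻¹ * U.costRatio i)) ≤ r) ∧
          ∀ n : Fin b → ℝ, (∀ i, 0 < n i) →
            (∀ i, U.costRatio i = ρ * (1 + Real.log (n i))) →
            ∃ (r β : ℝ) (α : Fin b → ℝ) (D : PMF (List (ElementaryTask b))),
              U.IsDiscreteAdversary r β α D ∧
              ρ * (1 + Real.log (∑ i, n i)) ≤ r ∧
              β ≤ lam₃ * U.costRatio ⟨0, by omega⟩ ∧
              ∀ i, (U.costRatio ⟨0, by omega⟩)⁻¹ ≤ α i) := by
  obtain ⟨lam₃, ρ, hlam₃, hρ, hadversary⟩ := mainTheorem4_general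
  refine ⟨lam₃, ρ, hlam₃, hρ, fun b hb Δ U hU hs hanti hone => ?_⟩
  have hmax (i : Fin b) : U.costRatio i ≤ U.costRatio ⟨0, by omega⟩ :=
    hanti (Fin.mk_le_of_le_val (Nat.zero_le _))
  have : Nonempty (Fin b) := ⟨⟨0, by omega⟩⟩
  obtain ⟨β, D, hD, hβ⟩ := hadversary b hb Δ U hU hs.ge _ hmax (hone _)
  exact ⟨fun _ => ⟨_, β, D, hD, hβ, le_rfl⟩, fun n hn hrn =>
    ⟨_, β, _, D, hD, (mul_log_sum_exp_eq hρ.ne' hn hrn).ge, hβ,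
      fun i => inv_anti₀ (U.costRatio_pos i) (hmax i)⟩⟩
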